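/- Let $p$ be a prime, $\mathbb F$ a field of characteristic $p$, $n\ge 1$ and $0\le k\le n$ integers. For $m\in\mathbb Z$ let $\Omega_m$ be the set of $m$-element subsets of $\{1,\dots,n\}$ and $\mathbb F\Omega_m$ the $\mathbb F$-vector space with basis $\Omega_m$ (zero unless $0\le m\le n$). Let $\varphi_m:\mathbb F\Omega_m\to\mathbb F\Omega_{m-1}$ be the linear map sending $\omega$ to the sum of all $\omega'\subset\omega$ with $|\omega'|=m-1$, and write $\varphi_m^r:\mathbb F\Omega_m\to\mathbb F\Omega_{m-r}$ for the $r$-fold composite; then $\varphi^p=0$. Let $$H_k^{/0}=\operatorname{Ker}(\varphi_k)/\operatorname{Im}(\varphi_{k+p-1}^{p-1})$$ be the zeroth slash homology group in degree $k$ of the $p$-complex $(\mathbb F\Omega_m,\varphi_m)_{m\in\mathbb Z}$, and let $C(k,1)_\bullet$ be the chain complex $$\cdots\to\mathbb F\Omega_{k+p}\xrightarrow{\varphi}\mathbb F\Omega_{k+p-1}\xrightarrow{\varphi^{p-1}}\mathbb F\Omega_k\xrightarrow{\varphi}\mathbb F\Omega_{k-1}\xrightarrow{\varphi^{p-1}}\mathbb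 F\Omega_{k-p}\to\cdots$$ with terms $\mathbb F\Omega_m$ for $m\equiv k$ or $m\equiv k-1 \pmod p$. Let $H_m(k,1)$ denote its homology at the term $\mathbb F\Omega_m$. 1. If $n-(p-1)<2k\le n$, then $H_m(k,1)=0$ for every such $m\ne k$. 2. $H_k(k,1)=H_k^{/0}$ (canonically, the class of a cycle corresponding to the class of the same cycle), and this space is non-zero if and only if $n-(p-1)<2k\le n$ and $p\ne2$. 3. If $n-(p-1)<2k\le n$ and $p\neq 2$, then $$\dim_{\mathbb F} H_k^{/0}=|\mathcal L^{1,p-1}_{n-k,k}|=\sum_{j\in\mathbb Z}\left[\binom{n}{pj+k}-\binom{n}{pj+k-1}\right],$$ where $\binom nr=0$ for integers $r\notin\{0,\dots,n\}$, and $\mathcal L^{1,p-1}_{n-k,k}$ is the set of $n$-step lattice paths from $(0,0)$ to $(n-k,k)$ with steps $(1,0)$ and $(0,1)$, all of whose points $(x,y)$ satisfy $-(p-1)<y-x<1$. -/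

import Mathlib

open CategoryTheory

/-! ### The graded space spanned by the subsets of an `n`-element set -/

/-- The `F`-vector space with basis all subsets of `{1, …, n}`. -/
abbrev SubsetSpace (F : Type*) [Field F] (n : ℕ) : Type _ := Finset (Fin n) →₀ F

/-- `F Ω_m`: the span of the `m`-subsets, as the degree `m` part of `SubsetSpace F n`.
It is zero when `m` is not in `{0, …, n}`. -/
def subsetModule (F : Type*) [Field F] (n : ℕ) (m : ℤ) : Submodule F (SubsetSpace F n) :=
  Finsupp.supported F F {ω : Finset (Fin n) | (ω.card : ℤ) = m}

/-- The map `φ`: it sends a subset `ω` to the sum of all `ω' ⊂ ω` with `|ω'| = |ω| - 1`. -/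
noncomputable def subsetBoundary (F : Type*) [Field F] (n : ℕ) :
    SubsetSpace F n →ₗ[F] SubsetSpace F n :=
  Finsupp.linearCombination F fun ω => ∑ i ∈ ω, Finsupp.single (ω.erase i) (1 : F)

/-- The part of `φ` that removes the element `i`. -/
noncomputable def removeElement (F : Type*) [Field F] (n : ℕ) (i : Fin n) :
    SubsetSpace F n →ₗ[F] SubsetSpace F n :=
  Finsupp.linearCombination F fun ω => if i ∈ ω then Finsupp.single (ω.erase i) (1 : F) else 0

lemma subsetBoundary_eq_sum (F : Type*) [Field F] (n : ℕ) :
    subsetBoundary F n = ∑ i : Fin n, removeElement F n i := by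
  refine Finsupp.lhom_ext' fun ω => LinearMap.ext_ring ?_
  simp [subsetBoundary, removeElement, Finset.sum_ite_mem]

lemma removeElement_commute (F : Type*) [Field F] (n : ℕ) (i j : Fin n) :
    Commute (removeElement F n i) (removeElement F n j) := by
  refine Finsupp.lhom_ext' fun ω => LinearMap.ext_ring ?_
  rcases eq_or_ne i j with rfl | hij
  · rfl
  by_cases hi : i ∈ ω <;> by_cases hj : j ∈ ω <;>
    simp [removeElement, Module.End.mul_apply, hi, hj, hij, hij.symm, Finset.mem_erase,
      Finset.erase_right_comm (a := i) (b := j)]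

lemma removeElement_sq (F : Type*) [Field F] (n : ℕ) (i : Fin n) :
    removeElement F n i ^ 2 = 0 := by
  refine Finsupp.lhom_ext' fun ω => LinearMap.ext_ring ?_
  by_cases hi : i ∈ ω <;> simp [removeElement, pow_two, Module.End.mul_apply, hi]

/-- `φ ^ p = 0` in characteristic `p`. -/
lemma subsetBoundary_pow_char (F : Type*) [Field F] (p : ℕ) [Fact p.Prime] [CharP F p] (n : ℕ) :
    subsetBoundary F n ^ p = 0 := by
  have hp : 2 ≤ p := (Fact.out : p.Prime).two_le
  have : CharP (Module.End F (SubsetSpace F n)) p :=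
    charP_of_injective_algebraMap
      (FaithfulSMul.algebraMap_injective F (Module.End F (SubsetSpace F n))) p
  rw [subsetBoundary_eq_sum]
  generalize (Finset.univ : Finset (Fin n)) = S
  induction S using Finset.induction_on with
  | empty => simp; omega
  | insert i S hi ih =>
    rw [Finset.sum_insert hi, add_pow_char_of_commute, ih, add_zero]
    · rw [show p = 2 + (p - 2) by omega, pow_add, removeElement_sq, zero_mul]
    · exact Commute.sum_right _ _ _ fun j _ => removeElement_commute F n i j

lemma subsetBoundary_mem (F : Type*) [Field F] (n : ℕ) {m : ℤ} {x : SubsetSpace F n}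
    (hx : x ∈ subsetModule F n m) : subsetBoundary F n x ∈ subsetModule F n (m - 1) := by
  rw [subsetBoundary, Finsupp.linearCombination_apply]
  refine Submodule.sum_mem _ fun ω hω => Submodule.smul_mem _ _ (Submodule.sum_mem _ fun i hi => ?_)
  have h1 : (ω.card : ℤ) = m := hx hω
  refine Finsupp.single_mem_supported F _ ?_
  have h2 := Finset.card_erase_add_one hi
  simp only [Set.mem_ofPred_eq]
  omega

/-- `φ ^ r` maps `F Ω_m` to `F Ω_{m-r}`. -/
lemma subsetBoundary_pow_mem (F : Type*) [Field F] (n r : ℕ) {m l : ℤ} (h : l = m - r) :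
    ∀ x ∈ subsetModule F n m, (subsetBoundary F n ^ r) x ∈ subsetModule F n l := by
  induction r generalizing l with
  | zero => intro x hx; simpa [h] using hx
  | succ r ih =>
    intro x hx
    have h3 := subsetBoundary_mem F n (ih (l := m - r) rfl x hx)
    rw [pow_succ', Module.End.mul_apply, show l = m - r - 1 by push_cast at h; omega]
    exact h3

/-- `φ_m ^ r : F Ω_m → F Ω_l`, for `l = m - r`. -/
noncomputable def boundaryPow (F : Type*) [Field F] (n r : ℕ) (m l : ℤ) (h : l = m - r) :
    subsetModule F n m →ₗ[F] subsetModule F n l :=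
  (subsetBoundary F n ^ r).restrict (subsetBoundary_pow_mem F n r h)

/-! ### Slash homology

A `p`-complex is given by a vector space `V`, its homogeneous parts `C k` (`k : ℤ`) and an
endomorphism `d` mapping `C k` to `C (k - 1)`, with `d ^ p = 0`. -/

/-- The kernel of `d ^ (a + 1)` in degree `k`. -/
def slashCycles {F V : Type*} [Field F] [AddCommGroup V] [Module F V]
    (C : ℤ → Submodule F V) (d : V →ₗ[F] V) (a : ℕ) (k : ℤ) : Submodule F V :=
  C k ⊓ LinearMap.ker (d ^ (a + 1))

/-- The sum, in degree `k`, of the image of `d ^ (p - a - 1)` and the kernel of `d ^ a`. -/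
def slashBoundaries {F V : Type*} [Field F] [AddCommGroup V] [Module F V]
    (p : ℕ) (C : ℤ → Submodule F V) (d : V →ₗ[F] V) (a : ℕ) (k : ℤ) : Submodule F V :=
  (C (k + (p - a - 1 : ℕ))).map (d ^ (p - a - 1)) ⊔ (C k ⊓ LinearMap.ker (d ^ a))

/-- The slash homology
`H_k^{/a} = Ker (d_k ^ (a+1)) / (Im (d_{k+p-a-1} ^ (p-a-1)) + Ker (d_k ^ a))`
of a `p`-complex, for `0 ≤ a ≤ p - 2`. -/
abbrev SlashHomology {F V : Type*} [Field F] [AddCommGroup V] [Module F V]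
    (p : ℕ) (C : ℤ → Submodule F V) (d : V →ₗ[F] V) (a : ℕ) (k : ℤ) : Type _ :=
  slashCycles C d a k ⧸ (slashBoundaries p C d a k).submoduleOf (slashCycles C d a k)

/-! ### The contracted complexes -/

/-- The index `m` of the term `F Ω_m` in position `i` of the contracted complex `C(k, a)`:
`m = p j + k` in position `i = 2 j`, and `m = p j + k - a` in position `i = 2 j - 1`. -/
def contractedDegree (p : ℕ) (k : ℤ) (a : ℕ) (i : ℤ) : ℤ :=
  if Even i then p * (i / 2) + k else p * ((i + 1) / 2) + k - a

/-- The differential leaving position `i` is `φ ^ a` for `i` even, `φ ^ (p - a)` for `i` odd. -/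
def contractedExponent (p a : ℕ) (i : ℤ) : ℕ := if Even i then a else p - a

lemma contractedDegree_step {p a : ℕ} (ha : a ∈ Finset.Icc 1 (p - 1)) (k : ℤ) {i j : ℤ}
    (h : j + 1 = i) :
    contractedDegree p k a j = contractedDegree p k a i - contractedExponent p a i := by
  have hap : a ≤ p := by have := Finset.mem_Icc.1 ha; omega
  subst h
  rcases Int.even_or_odd' j with ⟨t, rfl | rfl⟩
  · have h1 : (2 * t) / 2 = t := by omega
    have h2 : (2 * t + 1 + 1) / 2 = t + 1 := by omega
    have h3 : ¬ Even (2 * t + 1) := by simp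
    simp only [contractedDegree, contractedExponent, even_two_mul, h3, if_true, if_false, h1, h2,
      Nat.cast_sub hap]
    ring
  · have h1 : (2 * t + 1 + 1) / 2 = t + 1 := by omega
    have h3 : ¬ Even (2 * t + 1) := by simp
    have h4 : Even (2 * t + 1 + 1) := by simp [parity_simps]
    simp only [contractedDegree, contractedExponent, h3, h4, if_true, if_false, h1]

lemma contractedExponent_add {p a : ℕ} (ha : a ∈ Finset.Icc 1 (p - 1)) {i j : ℤ}
    (h : j + 1 = i) : contractedExponent p a j + contractedExponent p a i = p := by
  have hap : a ≤ p := by have := Finset.mem_Icc.1 ha; omega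
  subst h
  have h3 : Even (j + 1) ↔ ¬ Even j := Int.even_add_one
  by_cases hj : Even j
  · simp only [contractedExponent, h3, hj, not_true_eq_false, if_true, if_false]
    omega
  · simp only [contractedExponent, h3, hj, not_false_eq_true, if_true, if_false]
    omega

lemma contractedDegree_zero (p : ℕ) (k : ℤ) (a : ℕ) : contractedDegree p k a 0 = k := by
  simp [contractedDegree]

/-- The contracted complex `C(k, a)`, for `1 ≤ a ≤ p - 1`:
`⋯ → F Ω_{k+p} → F Ω_{k+p-a} → F Ω_k → F Ω_{k-a} → F Ω_{k-p} → ⋯`,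
with differentials alternately `φ ^ a` (out of `F Ω_{pj+k}`) and `φ ^ (p - a)`
(out of `F Ω_{pj+k-a}`). The term `F Ω_k` is in position `0`; the term in position `i` is
`F Ω_m` with `m = contractedDegree p k a i`. -/
noncomputable def contractedComplex (F : Type*) [Field F] (p : ℕ) [Fact p.Prime] [CharP F p]
    (n : ℕ) (k : ℤ) (a : ℕ) (ha : a ∈ Finset.Icc 1 (p - 1)) :
    ChainComplex (ModuleCat F) ℤ where
  X i := ModuleCat.of F (subsetModule F n (contractedDegree p k a i))
  d i j :=
    if h : j + 1 = i then
      ModuleCat.ofHom (boundaryPow F n (contractedExponent p a i) _ _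
        (contractedDegree_step ha k h))
    else 0
  shape i j h := dif_neg h
  d_comp_d' i j l hij hjl := by
    have h1 : j + 1 = i := hij
    have h2 : l + 1 = j := hjl
    rw [dif_pos h1, dif_pos h2, ← ModuleCat.ofHom_comp]
    refine ModuleCat.hom_ext (LinearMap.ext fun x => Subtype.ext ?_)
    change (subsetBoundary F n ^ contractedExponent p a j)
      ((subsetBoundary F n ^ contractedExponent p a i) x.1) = 0
    rw [← Module.End.mul_apply, ← pow_add, contractedExponent_add ha h1,
      subsetBoundary_pow_char F p n, LinearMap.zero_apply]

lemma one_mem_Icc_of_prime (p : ℕ) [hp : Fact p.Prime] : 1 ∈ Finset.Icc 1 (p - 1) :=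
  Finset.mem_Icc.2 ⟨le_rfl, Nat.le_sub_one_of_lt hp.out.one_lt⟩

/-! ### Binomial coefficients and lattice paths -/

/-- The binomial coefficient `C(n, r)` for an integer `r`; zero unless `0 ≤ r ≤ n`. -/
def intChoose (n : ℕ) (r : ℤ) : ℤ := if 0 ≤ r then (n.choose r.toNat : ℤ) else 0

/-- The set of lattice paths with `n` steps, each `(1, 0)` or `(0, 1)`, from `(0, 0)` to
`(n - k, k)`, all of whose points `(x, y)` satisfy `-t < y - x < s`. -/
def latticePaths (n : ℕ) (k : ℤ) (s t : ℕ) : Set (Fin (n + 1) → ℤ × ℤ) :=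
  {P | P 0 = (0, 0) ∧
    (∀ i : Fin n, P i.succ - P i.castSucc = (1, 0) ∨ P i.succ - P i.castSucc = (0, 1)) ∧
    P (Fin.last n) = ((n : ℤ) - k, k) ∧
    ∀ i, -(t : ℤ) < (P i).2 - (P i).1 ∧ (P i).2 - (P i).1 < s}

/-! The space spanned by the subsets of `Fin n`, with the operator `φ`, is the `n`-fold tensor power
of the two-dimensional Jordan block: splitting off one element identifies the space for `n + 1`
with two copies of the space for `n`, with `φ (x, y) = (φ x + y, φ y)`.

For `a + b = p`, let `H(n, a, m)` be the homology `Ker φ ^ a / Im φ ^ b` at `F Ω_m`. In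
characteristic `p` one has `b = -a`, and the shear `(x, y) ↦ (x, a y + φ x)` carries
`Ker φ ^ a` onto `Ker φ ^ (a + 1) × Ker φ ^ (a - 1)` and `Im φ ^ b` onto
`Im φ ^ (b - 1) × Im φ ^ (b + 1)` (`map_powCycles`, `map_powBoundaries`). Hence
`dim H(n + 1, a, m) = dim H(n, a + 1, m) + dim H(n, a - 1, m - 1)` for `0 < a < p`, and `H` vanishes
for `a = 0` and for `a = p`.

Removing the first step of a lattice path gives the same recursion for the number of paths in the
strip `-b < y - x < a` (`ncard_latticePaths_succ`), so this number is the dimension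
(`powHomologyDim_eq_ncard`). The end point has to lie in the strip, which gives all the vanishing,
for `a = 1` and `a = p - 1`; the alternating sum of binomial coefficients satisfies the
recursion too, by Pascal's rule (`finsum_intChoose_eq_ncard`), and whether there is a path
decides when `H_k^{/0}` is non-zero (`ncard_latticePaths_pos`). -/

/-! ### Splitting off one element -/

/-- A subset of `Fin (n + 1)` is `s.map succ` (left summand) or `{0} ∪ s.map succ`
(right summand) for a subset `s` of `Fin n`. -/
def finsetSumEquiv (n : ℕ) : Finset (Fin n) ⊕ Finset (Fin n) ≃ Finset (Fin (n + 1)) where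
  toFun := Sum.elim (fun s => s.map (Fin.succEmb n)) (fun s => insert 0 (s.map (Fin.succEmb n)))
  invFun s := if 0 ∈ s then Sum.inr ({i | Fin.succ i ∈ s} : Finset (Fin n))
    else Sum.inl ({i | Fin.succ i ∈ s} : Finset (Fin n))
  left_inv := by
    rintro (s | s) <;> simp
  right_inv s := by
    by_cases h : 0 ∈ s
    · simp only [h, if_true, Sum.elim_inr]
      ext i
      cases i using Fin.cases <;> simp [h]
    · simp only [h, if_false, Sum.elim_inl]
      ext i
      cases i using Fin.cases <;> simp [h]

lemma finsetSumEquiv_inl {n : ℕ} (s : Finset (Fin n)) :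
    finsetSumEquiv n (Sum.inl s) = s.map (Fin.succEmb n) := rfl

lemma finsetSumEquiv_inr {n : ℕ} (s : Finset (Fin n)) :
    finsetSumEquiv n (Sum.inr s) = insert 0 (s.map (Fin.succEmb n)) := rfl

/-- The isomorphism `(x, y) ↦ x + {0} ∪ y` from two copies of the space for `n` to the space for
`n + 1`. -/
noncomputable def splitEquiv (F : Type*) [Field F] (n : ℕ) :
    (SubsetSpace F n × SubsetSpace F n) ≃ₗ[F] SubsetSpace F (n + 1) :=
  (Finsupp.sumFinsuppLEquivProdFinsupp F).symm ≪≫ₗ Finsupp.domLCongr (finsetSumEquiv n)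

section Split

variable {F : Type*} [Field F] {n : ℕ}

lemma splitEquiv_single_left (ω : Finset (Fin n)) (c : F) :
    splitEquiv F n (Finsupp.single ω c, 0) = Finsupp.single (ω.map (Fin.succEmb n)) c := by
  have : (Finsupp.sumFinsuppLEquivProdFinsupp F).symm
      ((Finsupp.single ω c, 0) : SubsetSpace F n × SubsetSpace F n) =
      Finsupp.single (Sum.inl ω) c := by
    rw [LinearEquiv.symm_apply_eq]
    ext s <;> simp [Finsupp.single_apply]
  rw [splitEquiv, LinearEquiv.trans_apply, this, Finsupp.domLCongr_single]
  rfl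

lemma splitEquiv_single_right (ω : Finset (Fin n)) (c : F) :
    splitEquiv F n (0, Finsupp.single ω c) =
      Finsupp.single (insert 0 (ω.map (Fin.succEmb n))) c := by
  have : (Finsupp.sumFinsuppLEquivProdFinsupp F).symm
      ((0, Finsupp.single ω c) : SubsetSpace F n × SubsetSpace F n) =
      Finsupp.single (Sum.inr ω) c := by
    rw [LinearEquiv.symm_apply_eq]
    ext s <;> simp [Finsupp.single_apply]
  rw [splitEquiv, LinearEquiv.trans_apply, this, Finsupp.domLCongr_single]
  rfl

lemma subsetBoundary_single (ω : Finset (Fin n)) :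
    subsetBoundary F n (Finsupp.single ω 1) = ∑ i ∈ ω, Finsupp.single (ω.erase i) (1 : F) := by
  simp [subsetBoundary]

lemma subsetBoundary_splitEquiv (x y : SubsetSpace F n) :
    subsetBoundary F (n + 1) (splitEquiv F n (x, y)) =
      splitEquiv F n (subsetBoundary F n x + y, subsetBoundary F n y) := by
  let f : SubsetSpace F n × SubsetSpace F n →ₗ[F] SubsetSpace F (n + 1) :=
    subsetBoundary F (n + 1) ∘ₗ (splitEquiv F n).toLinearMap
  let g : SubsetSpace F n × SubsetSpace F n →ₗ[F] SubsetSpace F (n + 1) :=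
    (splitEquiv F n).toLinearMap ∘ₗ
      LinearMap.prod (subsetBoundary F n ∘ₗ LinearMap.fst F _ _ + LinearMap.snd F _ _)
        (subsetBoundary F n ∘ₗ LinearMap.snd F _ _)
  suffices f = g from LinearMap.congr_fun this (x, y)
  have hl (ω : Finset (Fin n)) (c : F) := splitEquiv_single_left ω c
  have hr (ω : Finset (Fin n)) (c : F) := splitEquiv_single_right ω c
  have h0 (s : Finset (Fin n)) : (0 : Fin (n + 1)) ∉ s.map (Fin.succEmb n) := by simp
  refine LinearMap.prod_ext ?_ ?_ <;> refine Finsupp.lhom_ext' fun ω => LinearMap.ext_ring ?_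
  · have e : ((∑ i ∈ ω, Finsupp.single (ω.erase i) (1 : F), 0) :
        SubsetSpace F n × SubsetSpace F n) =
        ∑ i ∈ ω, (Finsupp.single (ω.erase i) 1, 0) := by
      ext1 <;> simp [Prod.fst_sum, Prod.snd_sum]
    simp only [f, g, LinearMap.comp_apply, LinearMap.inl_apply, Finsupp.lsingle_apply,
      LinearEquiv.coe_coe, LinearMap.prod_apply, Function.prod_apply, LinearMap.add_apply,
      LinearMap.fst_apply, LinearMap.snd_apply, map_zero, add_zero]
    rw [hl, subsetBoundary_single, subsetBoundary_single, e, map_sum, Finset.sum_map]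
    refine Finset.sum_congr rfl fun i _ => ?_
    rw [hl, Finset.map_erase]
  · have e : ((Finsupp.single ω (1 : F), ∑ i ∈ ω, Finsupp.single (ω.erase i) (1 : F)) :
        SubsetSpace F n × SubsetSpace F n) =
        (Finsupp.single ω 1, 0) + ∑ i ∈ ω, (0, Finsupp.single (ω.erase i) 1) := by
      ext1 <;> simp [Prod.fst_sum, Prod.snd_sum]
    simp only [f, g, LinearMap.comp_apply, LinearMap.inr_apply, Finsupp.lsingle_apply,
      LinearEquiv.coe_coe, LinearMap.prod_apply, Function.prod_apply, LinearMap.add_apply,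
      LinearMap.fst_apply, LinearMap.snd_apply, map_zero, zero_add]
    rw [hr, subsetBoundary_single, subsetBoundary_single, e, map_add, map_sum,
      Finset.sum_insert (h0 ω), Finset.erase_insert (h0 ω), Finset.sum_map, hl]
    congr 1
    refine Finset.sum_congr rfl fun i _ => ?_
    rw [hr, Finset.map_erase, Finset.erase_insert_of_ne (by simp [(Fin.succ_ne_zero _).symm])]

/-- The binomial formula for `φ = φ ⊗ 1 + 1 ⊗ φ`, where the second summand squares to zero. -/
lemma subsetBoundary_pow_splitEquiv (r : ℕ) (x y : SubsetSpace F n) :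
    (subsetBoundary F (n + 1) ^ (r + 1)) (splitEquiv F n (x, y)) =
      splitEquiv F n ((subsetBoundary F n ^ (r + 1)) x + (r + 1 : F) • (subsetBoundary F n ^ r) y,
        (subsetBoundary F n ^ (r + 1)) y) := by
  induction r with
  | zero => simp [subsetBoundary_splitEquiv]
  | succ r ih =>
    rw [pow_succ', Module.End.mul_apply, ih, subsetBoundary_splitEquiv]
    congr 2
    · simp only [map_add, map_smul, ← Module.End.mul_apply, ← pow_succ', Nat.cast_add,
        Nat.cast_one]
      module
    · simp only [← Module.End.mul_apply, ← pow_succ']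

lemma splitEquiv_mem_subsetModule {m : ℤ} (x y : SubsetSpace F n) :
    splitEquiv F n (x, y) ∈ subsetModule F (n + 1) m ↔
      x ∈ subsetModule F n m ∧ y ∈ subsetModule F n (m - 1) := by
  have hx (s : Finset (Fin n)) : splitEquiv F n (x, y) (s.map (Fin.succEmb n)) = x s := by
    have : (finsetSumEquiv n).symm (s.map (Fin.succEmb n)) = Sum.inl s := by
      rw [Equiv.symm_apply_eq]; rfl
    simp [splitEquiv, this]
  have hy (s : Finset (Fin n)) :
      splitEquiv F n (x, y) (insert 0 (s.map (Fin.succEmb n))) = y s := by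
    have : (finsetSumEquiv n).symm (insert 0 (s.map (Fin.succEmb n))) = Sum.inr s := by
      rw [Equiv.symm_apply_eq]; rfl
    simp [splitEquiv, this]
  have h0 (s : Finset (Fin n)) : (0 : Fin (n + 1)) ∉ s.map (Fin.succEmb n) := by simp
  simp only [subsetModule, Finsupp.mem_supported, Set.subset_def, Finset.mem_coe,
    Finsupp.mem_support_iff, Set.mem_ofPred_eq]
  rw [(finsetSumEquiv n).symm.forall_congr_left, Sum.forall]
  refine and_congr (forall_congr' fun s => ?_) (forall_congr' fun s => ?_)
  · rw [Equiv.symm_symm, finsetSumEquiv_inl, hx, Finset.card_map]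
  · rw [Equiv.symm_symm, finsetSumEquiv_inr, hy, Finset.card_insert_of_notMem (h0 s),
      Finset.card_map]
    push_cast
    rw [eq_sub_iff_add_eq]

end Split

/-! ### The homology `Ker φ ^ a / Im φ ^ b` -/

/-- The kernel of `φ ^ a` on `F Ω_m`. -/
noncomputable def powCycles (F : Type*) [Field F] (n a : ℕ) (m : ℤ) :
    Submodule F (SubsetSpace F n) :=
  subsetModule F n m ⊓ LinearMap.ker (subsetBoundary F n ^ a)

/-- The image of `φ ^ b` in `F Ω_m`. -/
noncomputable def powBoundaries (F : Type*) [Field F] (n b : ℕ) (m : ℤ) :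
    Submodule F (SubsetSpace F n) :=
  (subsetModule F n (m + b)).map (subsetBoundary F n ^ b)

/-- The difference of the dimensions of `Ker φ ^ a` and `Im φ ^ b` on `F Ω_m`. For
`a + b = p` the image lies in the kernel, and this is the dimension of the quotient. -/
noncomputable def powHomologyDim (F : Type*) [Field F] (n a b : ℕ) (m : ℤ) : ℤ :=
  Module.finrank F (powCycles F n a m) - Module.finrank F (powBoundaries F n b m)

section PowHomology

variable {F : Type*} [Field F] {n : ℕ}

lemma powBoundaries_le_powCycles {p : ℕ} [Fact p.Prime] [CharP F p] {a b : ℕ} (hab : a + b = p)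
    (m : ℤ) : powBoundaries F n b m ≤ powCycles F n a m := by
  rintro _ ⟨x, hx, rfl⟩
  refine ⟨subsetBoundary_pow_mem F n b (by omega) x hx, ?_⟩
  rw [SetLike.mem_coe, LinearMap.mem_ker, ← Module.End.mul_apply, ← pow_add, hab,
    subsetBoundary_pow_char F p n, LinearMap.zero_apply]

lemma powCycles_eq_powBoundaries {p : ℕ} [Fact p.Prime] [CharP F p] {a b : ℕ} (hab : a + b = p)
    {m : ℤ} (h : powHomologyDim F n a b m = 0) : powCycles F n a m = powBoundaries F n b m := by
  refine (Submodule.eq_of_le_of_finrank_eq (powBoundaries_le_powCycles hab m) ?_).symm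
  unfold powHomologyDim at h
  omega

/-- The splitting of the space for `n + 1`, followed by the shear `(x, y) ↦ (x, c y + φ x)`. -/
noncomputable def shearEquiv (F : Type*) [Field F] (n : ℕ) (c : F) (hc : c ≠ 0) :
    SubsetSpace F (n + 1) ≃ₗ[F] (SubsetSpace F n × SubsetSpace F n) :=
  (splitEquiv F n).symm ≪≫ₗ
    LinearEquiv.ofBijective
      (LinearMap.prod (LinearMap.fst F _ _)
        (c • LinearMap.snd F _ _ + subsetBoundary F n ∘ₗ LinearMap.fst F _ _))
      ⟨by
        rintro ⟨x, y⟩ ⟨x', y'⟩ h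
        simp only [LinearMap.prod_apply, Function.prod_apply, LinearMap.fst_apply,
          LinearMap.add_apply, LinearMap.smul_apply, LinearMap.snd_apply, LinearMap.comp_apply,
          Prod.mk.injEq] at h
        obtain ⟨rfl, h⟩ := h
        have h := smul_right_injective _ hc (add_right_cancel h)
        simpa using h,
      fun ⟨x, z⟩ => ⟨(x, c⁻¹ • (z - subsetBoundary F n x)), by simp [hc]⟩⟩

lemma shearEquiv_splitEquiv {c : F} (hc : c ≠ 0) (x y : SubsetSpace F n) :
    shearEquiv F n c hc (splitEquiv F n (x, y)) = (x, c • y + subsetBoundary F n x) := by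
  simp only [shearEquiv, LinearEquiv.trans_apply, LinearEquiv.symm_apply_apply]
  rfl

lemma subsetBoundary_mem_sub {m l : ℤ} (h : l = m - 1) {x : SubsetSpace F n}
    (hx : x ∈ subsetModule F n m) : subsetBoundary F n x ∈ subsetModule F n l :=
  h ▸ subsetBoundary_mem F n hx

/-- For `c = a + 1` the shear decouples the two equations that describe `Ker φ ^ (a + 1)`, namely
`φ ^ (a + 1) x + (a + 1) φ ^ a y = 0` and `φ ^ (a + 1) y = 0`. -/
lemma map_powCycles {a : ℕ} (ha : (a + 1 : F) ≠ 0) (m : ℤ) :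
    (powCycles F (n + 1) (a + 1) m).map (shearEquiv F n (a + 1 : F) ha).toLinearMap =
      (powCycles F n (a + 2) m).prod (powCycles F n a (m - 1)) := by
  rw [Submodule.map_equiv_eq_comap_symm]
  ext v
  obtain ⟨w, rfl⟩ := (shearEquiv F n (a + 1 : F) ha).surjective v
  obtain ⟨⟨x, y⟩, rfl⟩ := (splitEquiv F n).surjective w
  rw [Submodule.mem_comap, LinearEquiv.coe_coe, LinearEquiv.symm_apply_apply,
    shearEquiv_splitEquiv]
  simp only [powCycles, Submodule.mem_inf, LinearMap.mem_ker, Submodule.mem_prod,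
    splitEquiv_mem_subsetModule, subsetBoundary_pow_splitEquiv, LinearEquiv.map_eq_zero_iff,
    Prod.mk_eq_zero]
  have hφ {l : ℕ} (z : SubsetSpace F n) : (subsetBoundary F n ^ l) (subsetBoundary F n z) =
      (subsetBoundary F n ^ (l + 1)) z := by rw [← Module.End.mul_apply, ← pow_succ]
  have hφ' {l : ℕ} (z : SubsetSpace F n) : subsetBoundary F n ((subsetBoundary F n ^ l) z) =
      (subsetBoundary F n ^ (l + 1)) z := by rw [← Module.End.mul_apply, ← pow_succ']
  have key : (subsetBoundary F n ^ a) ((a + 1 : F) • y + subsetBoundary F n x) =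
      (subsetBoundary F n ^ (a + 1)) x + (a + 1 : F) • (subsetBoundary F n ^ a) y := by
    rw [map_add, map_smul, hφ, add_comm]
  rw [key]
  constructor
  · rintro ⟨⟨hx, hy⟩, h1, h2⟩
    refine ⟨⟨hx, ?_⟩, Submodule.add_mem _ (Submodule.smul_mem _ _ hy) (subsetBoundary_mem F n hx),
      h1⟩
    have := congrArg (subsetBoundary F n) h1
    rwa [map_add, map_smul, hφ', hφ', h2, smul_zero, add_zero, map_zero] at this
  · rintro ⟨⟨hx, h1⟩, hy, h2⟩
    refine ⟨⟨hx, ?_⟩, h2, ?_⟩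
    · have := Submodule.sub_mem _ hy (subsetBoundary_mem F n hx)
      rw [add_sub_cancel_right] at this
      exact (Submodule.smul_mem_iff _ ha).1 this
    · have := congrArg (subsetBoundary F n) h2
      rw [map_add, map_smul, hφ', hφ', h1, zero_add, map_zero] at this
      exact (smul_eq_zero_iff_right ha).1 this

/-- The counterpart of `map_powCycles` for images. The hypothesis `hab` holds in characteristic
`(a + 1) + (b + 1)`. -/
lemma map_powBoundaries {a b : ℕ} (ha : (a + 1 : F) ≠ 0) (hab : (a + 1 : F) = -(b + 1)) (m : ℤ) :
    (powBoundaries F (n + 1) (b + 1) m).map (shearEquiv F n (a + 1 : F) ha).toLinearMap =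
      (powBoundaries F n b m).prod (powBoundaries F n (b + 2) (m - 1)) := by
  have hb : (b + 1 : F) ≠ 0 := fun h => ha (by rw [hab, h, neg_zero])
  have hφ {l : ℕ} (z : SubsetSpace F n) : (subsetBoundary F n ^ l) (subsetBoundary F n z) =
      (subsetBoundary F n ^ (l + 1)) z := by rw [← Module.End.mul_apply, ← pow_succ]
  have hφ' {l : ℕ} (z : SubsetSpace F n) : subsetBoundary F n ((subsetBoundary F n ^ l) z) =
      (subsetBoundary F n ^ (l + 1)) z := by rw [← Module.End.mul_apply, ← pow_succ']
  -- In terms of `u = φ x + (b + 1) y`, the image of `(x, y)` under `φ ^ (b + 1)` and the shear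
  -- is `(φ ^ b u, φ ^ (b + 2) x)`.
  have key (x y : SubsetSpace F n) :
      shearEquiv F n (a + 1 : F) ha
        ((subsetBoundary F (n + 1) ^ (b + 1)) (splitEquiv F n (x, y))) =
      ((subsetBoundary F n ^ b) (subsetBoundary F n x + (b + 1 : F) • y),
        (subsetBoundary F n ^ (b + 2)) x) := by
    rw [subsetBoundary_pow_splitEquiv, shearEquiv_splitEquiv, hab]
    simp only [map_add, map_smul, hφ, hφ', Prod.mk.injEq, true_and]
    module
  have e1 : m + ((b + 1 : ℕ) : ℤ) - 1 = m + b := by push_cast; ring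
  have e2 : m - 1 + ((b + 2 : ℕ) : ℤ) = m + ((b + 1 : ℕ) : ℤ) := by push_cast; ring
  ext ⟨v, w⟩
  simp only [powBoundaries, Submodule.mem_prod, e2]
  constructor
  · rintro ⟨_, ⟨t, ht, rfl⟩, h⟩
    obtain ⟨⟨x, y⟩, rfl⟩ := (splitEquiv F n).surjective t
    obtain ⟨hx, hy⟩ := (splitEquiv_mem_subsetModule x y).1 ht
    rw [e1] at hy
    rw [LinearEquiv.coe_coe, key, Prod.mk.injEq] at h
    exact ⟨⟨_, Submodule.add_mem _ (subsetBoundary_mem_sub e1.symm hx)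
      (Submodule.smul_mem _ _ hy), h.1⟩, x, hx, h.2⟩
  · rintro ⟨⟨u, hu, rfl⟩, x, hx, rfl⟩
    refine ⟨_, ⟨splitEquiv F n (x, (b + 1 : F)⁻¹ • (u - subsetBoundary F n x)),
      (splitEquiv_mem_subsetModule _ _).2 ⟨hx, ?_⟩, rfl⟩, ?_⟩
    · exact Submodule.smul_mem _ _ (Submodule.sub_mem _ (e1.symm ▸ hu) (subsetBoundary_mem F n hx))
    · rw [LinearEquiv.coe_coe, key, smul_smul, mul_inv_cancel₀ hb, one_smul,
        add_sub_cancel]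

lemma finrank_submodule_prod {V W : Type*} [AddCommGroup V] [Module F V] [AddCommGroup W]
    [Module F W] [FiniteDimensional F V] [FiniteDimensional F W] (S : Submodule F V)
    (T : Submodule F W) :
    Module.finrank F (S.prod T) = Module.finrank F S + Module.finrank F T := by
  rw [← Module.finrank_prod]
  exact LinearEquiv.finrank_eq
    { toFun := fun x => (⟨x.1.1, x.2.1⟩, ⟨x.1.2, x.2.2⟩)
      invFun := fun x => ⟨(x.1, x.2), x.1.2, x.2.2⟩
      map_add' := fun _ _ => rfl
      map_smul' := fun _ _ => rfl }

/-- Tensoring with the two-dimensional Jordan block turns a block of size `s < p` into blocks of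
sizes `s + 1` and `s - 1`; this is the resulting recursion for the homology. -/
lemma powHomologyDim_succ {a b : ℕ} (ha : (a + 1 : F) ≠ 0) (hab : (a + 1 : F) = -(b + 1))
    (m : ℤ) : powHomologyDim F (n + 1) (a + 1) (b + 1) m =
      powHomologyDim F n (a + 2) b m + powHomologyDim F n a (b + 2) (m - 1) := by
  have h1 := LinearEquiv.finrank_map_eq (shearEquiv F n (a + 1 : F) ha)
    (powCycles F (n + 1) (a + 1) m)
  have h2 := LinearEquiv.finrank_map_eq (shearEquiv F n (a + 1 : F) ha)
    (powBoundaries F (n + 1) (b + 1) m)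
  rw [map_powCycles, finrank_submodule_prod] at h1
  rw [map_powBoundaries ha hab, finrank_submodule_prod] at h2
  unfold powHomologyDim
  omega

lemma powHomologyDim_zero_left {p : ℕ} [Fact p.Prime] [CharP F p] (m : ℤ) :
    powHomologyDim F n 0 p m = 0 := by
  have h1 : powCycles F n 0 m = ⊥ := by
    rw [powCycles, pow_zero, Module.End.one_eq_id, LinearMap.ker_id, inf_bot_eq]
  have h2 : powBoundaries F n p m = ⊥ := by
    rw [powBoundaries, subsetBoundary_pow_char F p n, Submodule.map_zero]
  rw [powHomologyDim, h1, h2, sub_self]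

lemma powHomologyDim_zero_right {p : ℕ} [Fact p.Prime] [CharP F p] (m : ℤ) :
    powHomologyDim F n p 0 m = 0 := by
  have h1 : powCycles F n p m = subsetModule F n m := by
    rw [powCycles, subsetBoundary_pow_char F p n, LinearMap.ker_zero, inf_top_eq]
  have h2 : powBoundaries F n 0 m = subsetModule F n m := by
    rw [powBoundaries, pow_zero, Module.End.one_eq_id, Submodule.map_id, Nat.cast_zero, add_zero]
  rw [powHomologyDim, h1, h2, sub_self]

lemma powHomologyDim_zero (a b : ℕ) (m : ℤ) :
    powHomologyDim F 0 (a + 1) (b + 1) m = if m = 0 then 1 else 0 := by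
  have hφ : subsetBoundary F 0 = 0 := by
    rw [subsetBoundary_eq_sum, Finset.univ_eq_empty, Finset.sum_empty]
  have h1 : powCycles F 0 (a + 1) m = subsetModule F 0 m := by
    rw [powCycles, hφ, zero_pow a.succ_ne_zero, LinearMap.ker_zero, inf_top_eq]
  have h2 : powBoundaries F 0 (b + 1) m = ⊥ := by
    rw [powBoundaries, hφ, zero_pow b.succ_ne_zero, Submodule.map_zero]
  have h3 (ω : Finset (Fin 0)) : ω.card = 0 := by
    rw [Finset.eq_empty_of_isEmpty ω, Finset.card_empty]
  rw [powHomologyDim, h1, h2, finrank_bot, Nat.cast_zero, sub_zero, subsetModule]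
  split_ifs with hm
  · have : {ω : Finset (Fin 0) | (ω.card : ℤ) = m} = Set.univ := by
      ext ω; simp [hm]
    rw [this, Finsupp.supported_univ, finrank_top, Module.finrank_finsupp_self]
    simp
  · have : {ω : Finset (Fin 0) | (ω.card : ℤ) = m} = ∅ := by
      ext ω; simp [h3 ω, Ne.symm hm]
    rw [this, Finsupp.supported_empty, finrank_bot, Nat.cast_zero]

end PowHomology

/-! ### Lattice paths in a strip -/

section LatticePaths

/-- The lattice path from the origin with first step `v`, continued by the translate of `Q` by
`v`. -/
def consStep {n : ℕ} (v : ℤ × ℤ) (Q : Fin (n + 1) → ℤ × ℤ) : Fin (n + 2) → ℤ × ℤ :=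
  Fin.cons 0 fun i => v + Q i

lemma consStep_injective {n : ℕ} (v : ℤ × ℤ) : Function.Injective (consStep (n := n) v) := by
  intro Q Q' h
  funext i
  simpa [consStep] using congrFun h i.succ

/-- The end point of a path has to lie in the strip. -/
lemma latticePaths_eq_empty {n : ℕ} {k : ℤ} {s t : ℕ}
    (h : ¬ (-(t : ℤ) < 2 * k - n ∧ 2 * k - n < s)) : latticePaths n k s t = ∅ := by
  rw [Set.eq_empty_iff_forall_notMem]
  rintro P ⟨-, -, h2, h3⟩
  have := h3 (Fin.last n)
  rw [h2] at this
  apply h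
  constructor <;> linarith [this.1, this.2]

lemma latticePaths_eq_empty_of_start {n : ℕ} {k : ℤ} {s t : ℕ} (h : s = 0 ∨ t = 0) :
    latticePaths n k s t = ∅ := by
  rw [Set.eq_empty_iff_forall_notMem]
  rintro P ⟨h1, -, -, h3⟩
  have := h3 0
  rw [h1] at this
  simp only [sub_zero] at this
  omega

/-- Seen from the end of the first step `v`, the strip is translated, which changes its bounds
to `s'` and `t'`. -/
lemma consStep_mem_latticePaths {n : ℕ} {k d : ℤ} {s t s' t' : ℕ} {v : ℤ × ℤ}
    (hv : v = (1, 0) ∨ v = (0, 1)) (hd : d = v.2) (hs' : (s' : ℤ) = s + 1 + v.1 - v.2)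
    (ht' : (t' : ℤ) = t + 1 + v.2 - v.1) (Q : Fin (n + 1) → ℤ × ℤ) (hQ : Q 0 = 0) :
    consStep v Q ∈ latticePaths (n + 1) k (s + 1) (t + 1) ↔
      Q ∈ latticePaths n (k - d) s' t' := by
  subst hd
  have hv' : v.1 + v.2 = 1 := by rcases hv with rfl | rfl <;> simp
  simp only [latticePaths, Set.mem_ofPred_eq]
  refine and_congr (by simp [consStep, hQ]) (and_congr ?_ (and_congr ?_ ?_))
  · rw [Fin.forall_fin_succ]
    have h0 : consStep v Q (Fin.succ 0) - consStep v Q (Fin.castSucc 0) = v := by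
      simp [consStep, hQ]
    have h1 (i : Fin n) : consStep v Q i.succ.succ - consStep v Q i.succ.castSucc =
        Q i.succ - Q i.castSucc := by
      rw [← Fin.succ_castSucc]; simp [consStep]
    simp only [h0, h1, hv, true_and]
  · rw [← Fin.succ_last]
    simp only [consStep, Fin.cons_succ, Prod.ext_iff, Prod.fst_add, Prod.snd_add]
    push_cast
    constructor <;> rintro ⟨h1, h2⟩ <;> constructor <;> linarith
  · rw [Fin.forall_fin_succ]
    have h0 : -((t + 1 : ℕ) : ℤ) < (consStep v Q 0).2 - (consStep v Q 0).1 ∧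
        (consStep v Q 0).2 - (consStep v Q 0).1 < ((s + 1 : ℕ) : ℤ) := by
      simp [consStep]; omega
    simp only [h0, true_and, and_true]
    refine forall_congr' fun i => ?_
    simp only [consStep, Fin.cons_succ, Prod.fst_add, Prod.snd_add]
    push_cast
    rw [hs', ht']
    constructor <;> rintro ⟨h1, h2⟩ <;> constructor <;> linarith

/-- A path is split according to its first step. -/
lemma latticePaths_succ (n : ℕ) (k : ℤ) (s t : ℕ) :
    latticePaths (n + 1) k (s + 1) (t + 1) =
      consStep (1, 0) '' latticePaths n k (s + 2) t ∪
        consStep (0, 1) '' latticePaths n (k - 1) s (t + 2) := by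
  have hx (Q : Fin (n + 1) → ℤ × ℤ) (hQ : Q 0 = 0) := consStep_mem_latticePaths (n := n) (k := k)
    (d := 0) (s := s) (t := t) (s' := s + 2) (t' := t) (v := (1, 0)) (Or.inl rfl) rfl
    (by push_cast; ring) (by push_cast; ring) Q hQ
  have hy (Q : Fin (n + 1) → ℤ × ℤ) (hQ : Q 0 = 0) := consStep_mem_latticePaths (n := n) (k := k)
    (d := 1) (s := s) (t := t) (s' := s) (t' := t + 2) (v := (0, 1)) (Or.inr rfl) rfl
    (by push_cast; ring) (by push_cast; ring) Q hQ
  rw [sub_zero] at hx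
  ext P
  constructor
  · intro hP
    have hstep := hP.2.1 0
    have h0 : P 0 = 0 := hP.1
    have hcons : consStep (P 1) (fun i => P i.succ - P 1) = P := by
      funext i
      cases i using Fin.cases with
      | zero => simp [consStep, h0]
      | succ i => simp [consStep]
    have hz : (fun i : Fin (n + 1) => P i.succ - P 1) 0 = 0 := by simp
    simp only [Fin.succ_zero_eq_one, Fin.castSucc_zero, h0, sub_zero] at hstep
    rw [← hcons] at hP
    rcases hstep with h | h
    · rw [h] at hP hcons hz
      exact Or.inl ⟨_, (hx _ hz).1 hP, hcons⟩
    · rw [h] at hP hcons hz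
      exact Or.inr ⟨_, (hy _ hz).1 hP, hcons⟩
  · rintro (⟨Q, hQ, rfl⟩ | ⟨Q, hQ, rfl⟩)
    · exact (hx Q hQ.1).2 hQ
    · exact (hy Q hQ.1).2 hQ

lemma latticePaths_zero (k : ℤ) (s t : ℕ) :
    latticePaths 0 k (s + 1) (t + 1) = if k = 0 then {0} else ∅ := by
  ext P
  have hP : P = 0 ↔ P 0 = (0, 0) := by
    rw [funext_iff, Fin.forall_fin_one]; rfl
  split_ifs with hk
  · rw [Set.mem_singleton_iff, hP]
    refine ⟨fun h => h.1, fun h => ⟨h, fun i => i.elim0, ?_, fun i => ?_⟩⟩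
    · simpa [hk] using h
    · rw [show i = 0 from Fin.fin_one_eq_zero i, h]
      simp only [sub_zero]
      omega
  · simp only [Set.mem_empty_iff_false, iff_false]
    rintro ⟨h1, -, h3, -⟩
    rw [show Fin.last 0 = 0 from rfl, h1, Prod.mk.injEq] at h3
    exact hk h3.2.symm

lemma latticePaths_finite (n : ℕ) (k : ℤ) (s t : ℕ) : (latticePaths n k s t).Finite := by
  induction n generalizing k s t with
  | zero =>
    rcases s with - | s
    · simp [latticePaths_eq_empty_of_start]
    rcases t with - | t
    · simp [latticePaths_eq_empty_of_start]
    rw [latticePaths_zero]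
    split_ifs <;> simp
  | succ n ih =>
    rcases s with - | s
    · simp [latticePaths_eq_empty_of_start]
    rcases t with - | t
    · simp [latticePaths_eq_empty_of_start]
    rw [latticePaths_succ]
    exact ((ih _ _ _).image _).union ((ih _ _ _).image _)

lemma ncard_latticePaths_succ (n : ℕ) (k : ℤ) (s t : ℕ) :
    (latticePaths (n + 1) k (s + 1) (t + 1)).ncard =
      (latticePaths n k (s + 2) t).ncard + (latticePaths n (k - 1) s (t + 2)).ncard := by
  rw [latticePaths_succ, Set.ncard_union_eq ?_ ((latticePaths_finite _ _ _ _).image _)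
    ((latticePaths_finite _ _ _ _).image _), Set.ncard_image_of_injective _ (consStep_injective _),
    Set.ncard_image_of_injective _ (consStep_injective _)]
  · rw [Set.disjoint_left]
    rintro _ ⟨Q, hQ, rfl⟩ ⟨Q', hQ', h⟩
    have := congrFun h 1
    rw [← Fin.succ_zero_eq_one] at this
    simp [consStep, show Q 0 = 0 from hQ.1, show Q' 0 = 0 from hQ'.1] at this

lemma ncard_latticePaths_pos {n : ℕ} {k : ℤ} {s t : ℕ} (hk0 : 0 ≤ k) (hkn : k ≤ n)
    (hs : 0 < s) (ht : 0 < t) (hst : 3 ≤ s + t) (h1 : -(t : ℤ) < 2 * k - n)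
    (h2 : 2 * k - n < s) : 0 < (latticePaths n k s t).ncard := by
  induction n generalizing k s t with
  | zero =>
    obtain ⟨s, rfl⟩ := Nat.exists_eq_add_of_le' hs
    obtain ⟨t, rfl⟩ := Nat.exists_eq_add_of_le' ht
    obtain rfl : k = 0 := by push_cast at hkn; omega
    simp [latticePaths_zero]
  | succ n ih =>
    obtain ⟨s, rfl⟩ := Nat.exists_eq_add_of_le' hs
    obtain ⟨t, rfl⟩ := Nat.exists_eq_add_of_le' ht
    rw [ncard_latticePaths_succ]
    push_cast at h1 h2 hkn
    -- If a first step in one direction leaves the strip or passes the end point, the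
    -- inequalities leave room for a first step in the other direction.
    by_cases h : 0 < t ∧ k ≤ n
    · refine Nat.add_pos_left (ih hk0 h.2 ?_ h.1 ?_ ?_ ?_) _ <;> (try push_cast) <;> omega
    · refine Nat.add_pos_right _ (ih ?_ ?_ ?_ ?_ ?_ ?_ ?_) <;> (try push_cast) <;> omega

end LatticePaths

/-! ### Alternating sums of binomial coefficients -/

lemma intChoose_succ (n : ℕ) (r : ℤ) :
    intChoose (n + 1) r = intChoose n r + intChoose n (r - 1) := by
  unfold intChoose
  rcases lt_trichotomy r 0 with h | rfl | h
  · simp [h.not_ge, show ¬ (1 ≤ r) by omega]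
  · simp
  · obtain ⟨m, rfl⟩ : ∃ m : ℕ, r = m + 1 := ⟨(r - 1).toNat, by omega⟩
    rw [if_pos h.le, if_pos h.le, if_pos (by omega), add_sub_cancel_right,
      Int.toNat_natCast_add_one, Int.toNat_natCast, Nat.choose_succ_succ]
    push_cast
    ring

lemma intChoose_zero (r : ℤ) : intChoose 0 r = if r = 0 then 1 else 0 := by
  unfold intChoose
  rcases lt_trichotomy r 0 with h | rfl | h
  · simp [h.not_ge, h.ne]
  · simp
  · obtain ⟨m, rfl⟩ : ∃ m : ℕ, r = m + 1 := ⟨(r - 1).toNat, by omega⟩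
    rw [if_pos h.le, if_neg h.ne', Int.toNat_natCast_add_one, Nat.choose_zero_succ, Nat.cast_zero]

lemma finite_support_intChoose {p : ℕ} (hp : 0 < p) (n : ℕ) (r : ℤ) :
    (Function.support fun j : ℤ => intChoose n (p * j + r)).Finite := by
  have hinj : Function.Injective fun j : ℤ => (p : ℤ) * j + r := fun i j h => by
    simpa [hp.ne'] using h
  refine ((Set.finite_Icc (0 : ℤ) n).preimage hinj.injOn).subset fun j hj => ?_
  rw [Function.mem_support, intChoose] at hj
  split_ifs at hj with h
  · refine ⟨h, ?_⟩
    by_contra! hlt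
    exact hj (by rw [Nat.choose_eq_zero_of_lt (by omega), Nat.cast_zero])
  · exact absurd rfl hj

/-- The two parts of the sum differ by a shift of `j`. -/
lemma finsum_intChoose_sub_width {p : ℕ} (hp : 0 < p) (n : ℕ) (k : ℤ) :
    ∑ᶠ j : ℤ, (intChoose n (p * j + k) - intChoose n (p * j + k - p)) = 0 := by
  have hshift := finsum_comp_equiv (Equiv.subRight (1 : ℤ))
    (f := fun j : ℤ => intChoose n (p * j + k))
  have e (j : ℤ) : (p : ℤ) * j + k - p = p * (j - 1) + k := by ring
  simp only [Equiv.subRight_apply] at hshift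
  have hfin : (Function.support fun j : ℤ => intChoose n (p * j + k - p)).Finite := by
    simpa only [add_sub_assoc] using finite_support_intChoose hp n (k - p)
  rw [finsum_sub_distrib (finite_support_intChoose hp n k) hfin]
  simp only [e]
  rw [hshift, sub_self]

/-- The reflection formula for the number of lattice paths in a strip of width `p = s + t`. Both
sides satisfy the recursion of `ncard_latticePaths_succ`, and both vanish for `s = 0` and
for `t = 0`. -/
lemma finsum_intChoose_eq_ncard {p : ℕ} (hp : 0 < p) {n : ℕ} {k : ℤ} {s t : ℕ} (hst : s + t = p)
    (h1 : -(t : ℤ) < 2 * k - n) (h2 : 2 * k - n < s) :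
    ∑ᶠ j : ℤ, (intChoose n (p * j + k) - intChoose n (p * j + k - s)) =
      (latticePaths n k s t).ncard := by
  induction n generalizing k s t with
  | zero =>
    rcases s with - | s
    · simp [latticePaths_eq_empty_of_start]
    rcases t with - | t
    · rw [latticePaths_eq_empty_of_start (Or.inr rfl), Set.ncard_empty, Nat.cast_zero,
        ← finsum_intChoose_sub_width hp 0 k, ← hst, add_zero]
    have hterm (j : ℤ) : intChoose 0 (p * j + k) - intChoose 0 (p * j + k - (s + 1 : ℕ)) =
        if j = 0 then (if k = 0 then 1 else 0) else 0 := by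
      have hst' : (p : ℤ) = s + t + 2 := by rw [← hst]; push_cast; ring
      push_cast at h1 h2
      rw [intChoose_zero, intChoose_zero]
      -- The inequalities give `-p < k < p` and `-p < k - (s + 1) < 0`.
      rcases lt_trichotomy j 0 with hj | rfl | hj
      · have : (p : ℤ) * j ≤ p * (-1) := mul_le_mul_of_nonneg_left (by omega) (by omega)
        rw [if_neg (by omega), if_neg (by push_cast; omega), if_neg hj.ne, sub_zero]
      · rw [mul_zero, zero_add, if_pos rfl, if_neg (c := k - (s + 1 : ℕ) = 0) (by push_cast; omega),
          sub_zero]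
      · have : (p : ℤ) * 1 ≤ p * j := mul_le_mul_of_nonneg_left (by omega) (by omega)
        rw [if_neg (by omega), if_neg (by push_cast; omega), if_neg hj.ne', sub_zero]
    simp only [hterm]
    rw [finsum_eq_single _ 0 fun j hj => if_neg hj, if_pos rfl, latticePaths_zero]
    split_ifs <;> simp
  | succ n ih =>
    rcases s with - | s
    · simp [latticePaths_eq_empty_of_start]
    rcases t with - | t
    · rw [latticePaths_eq_empty_of_start (Or.inr rfl), Set.ncard_empty, Nat.cast_zero,
        ← finsum_intChoose_sub_width hp (n + 1) k, ← hst, add_zero]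
    have hfin (k : ℤ) (s : ℕ) : (Function.support fun j : ℤ =>
        intChoose n (p * j + k) - intChoose n (p * j + k - s)).Finite := by
      have := (finite_support_intChoose hp n k).union (finite_support_intChoose hp n (k - s))
      simp only [← add_sub_assoc] at this
      exact this.subset (Function.support_sub _ _)
    rw [ncard_latticePaths_succ, Nat.cast_add (latticePaths n k (s + 2) t).ncard,
      ← ih (k := k) (s := s + 2) (t := t) (by omega) (by push_cast at h1; omega)
        (by push_cast at h2 ⊢; omega),
      ← ih (k := k - 1) (s := s) (t := t + 2) (by omega) (by push_cast at h1 ⊢; omega)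
        (by push_cast at h2; omega),
      ← finsum_add_distrib (hfin _ _) (hfin _ _)]
    refine finsum_congr fun j => ?_
    have e1 : (p : ℤ) * j + (k - 1) = p * j + k - 1 := by ring
    have e2 : (p : ℤ) * j + k - ((s + 1 : ℕ) : ℤ) = p * j + k - 1 - s := by push_cast; ring
    have e3 : (p : ℤ) * j + k - ((s + 2 : ℕ) : ℤ) = p * j + k - 1 - s - 1 := by push_cast; ring
    rw [e1, e2, e3, intChoose_succ, intChoose_succ]
    ring

/-! ### The dimension of the homology -/

lemma slashBoundaries_eq_powBoundaries (F : Type*) [Field F] (p n : ℕ) (k : ℤ) :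
    slashBoundaries p (subsetModule F n) (subsetBoundary F n) 0 k =
      powBoundaries F n (p - 1) k := by
  rw [slashBoundaries, pow_zero, Module.End.one_eq_id, LinearMap.ker_id, inf_bot_eq, sup_bot_eq]
  rfl

section Homology

variable (F : Type*) [Field F] (p : ℕ) [Fact p.Prime] [CharP F p] (n : ℕ)

/-- The homology of `F Ω_m` with respect to `φ ^ a` and `φ ^ b` has a dimension equal to the number
of lattice paths to `(n - m, m)` in the strip `-b < y - x < a`. -/
theorem powHomologyDim_eq_ncard {a b : ℕ} (hab : a + b = p) (m : ℤ) :
    powHomologyDim F n a b m = (latticePaths n m a b).ncard := by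
  induction n generalizing a b m with
  | zero =>
    rcases a with - | a
    · obtain rfl : b = p := by omega
      rw [powHomologyDim_zero_left, latticePaths_eq_empty_of_start (Or.inl rfl)]
      simp
    rcases b with - | b
    · obtain rfl : a + 1 = p := by omega
      rw [powHomologyDim_zero_right, latticePaths_eq_empty_of_start (Or.inr rfl)]
      simp
    rw [powHomologyDim_zero, latticePaths_zero]
    split_ifs <;> simp
  | succ n ih =>
    rcases a with - | a
    · obtain rfl : b = p := by omega
      rw [powHomologyDim_zero_left, latticePaths_eq_empty_of_start (Or.inl rfl)]
      simp
    rcases b with - | b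
    · obtain rfl : a + 1 = p := by omega
      rw [powHomologyDim_zero_right, latticePaths_eq_empty_of_start (Or.inr rfl)]
      simp
    have ha : (a + 1 : F) ≠ 0 := by
      intro h
      have h' : ((a + 1 : ℕ) : F) = 0 := by exact_mod_cast h
      rw [CharP.cast_eq_zero_iff F p] at h'
      exact absurd (Nat.le_of_dvd a.succ_pos h') (by omega)
    have hab' : (a + 1 : F) = -(b + 1) := by
      rw [eq_neg_iff_add_eq_zero]
      have := CharP.cast_eq_zero F p
      rw [← hab] at this
      exact_mod_cast this
    rw [powHomologyDim_succ ha hab', ih (by omega), ih (by omega), ncard_latticePaths_succ,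
      Nat.cast_add]

lemma finrank_slashHomology (k : ℤ) :
    Module.finrank F (SlashHomology p (subsetModule F n) (subsetBoundary F n) 0 k) =
      (latticePaths n k 1 (p - 1)).ncard := by
  have hp : 1 + (p - 1) = p := by have := (Fact.out : p.Prime).pos; omega
  have hle : slashBoundaries p (subsetModule F n) (subsetBoundary F n) 0 k ≤
      slashCycles (subsetModule F n) (subsetBoundary F n) 0 k := by
    rw [slashBoundaries_eq_powBoundaries]
    exact powBoundaries_le_powCycles hp k
  have h1 := Submodule.finrank_quotient_add_finrank
    (M := slashCycles (subsetModule F n) (subsetBoundary F n) 0 k)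
    ((slashBoundaries p (subsetModule F n) (subsetBoundary F n) 0 k).submoduleOf
      (slashCycles (subsetModule F n) (subsetBoundary F n) 0 k))
  have h2 := (Submodule.submoduleOfEquivOfLe hle).finrank_eq
  have h3 := powHomologyDim_eq_ncard F p n hp k
  have h4 : Module.finrank F (slashBoundaries p (subsetModule F n) (subsetBoundary F n) 0 k) =
      Module.finrank F (powBoundaries F n (p - 1) k) := by
    rw [slashBoundaries_eq_powBoundaries]
  have h5 : Module.finrank F (slashCycles (subsetModule F n) (subsetBoundary F n) 0 k) =
      Module.finrank F (powCycles F n 1 k) := rfl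
  unfold powHomologyDim at h3
  change _ = Module.finrank F _ at h1
  unfold SlashHomology
  omega

/-! ### The contracted complex -/

variable {F p n} {k : ℤ} {a : ℕ} {ha : a ∈ Finset.Icc 1 (p - 1)}

lemma contractedComplex_d_apply {i j : ℤ} (h : j + 1 = i)
    (x : (contractedComplex F p n k a ha).X i) :
    (subsetModule F n (contractedDegree p k a j)).subtype
        ((contractedComplex F p n k a ha).d i j x) =
      (subsetBoundary F n ^ contractedExponent p a i)
        ((subsetModule F n (contractedDegree p k a i)).subtype x) := by
  subst h
  simp only [contractedComplex, dif_pos]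
  rfl

lemma contractedComplex_isZero_homology {i : ℤ}
    (h : powCycles F n (contractedExponent p a i) (contractedDegree p k a i) =
      powBoundaries F n (contractedExponent p a (i + 1)) (contractedDegree p k a i)) :
    Limits.IsZero ((contractedComplex F p n k a ha).homology i) := by
  apply HomologicalComplex.ExactAt.isZero_homology
  rw [HomologicalComplex.exactAt_iff' _ (i + 1) i (i - 1) (ChainComplex.prev _ _)
    (ComplexShape.next_eq' _ (by simp)), ShortComplex.moduleCat_exact_iff]
  intro x hx
  have hx0 : (subsetBoundary F n ^ contractedExponent p a i) x.1 = 0 :=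
    (contractedComplex_d_apply (ha := ha) (sub_add_cancel i 1) x).symm.trans
      (congrArg Subtype.val hx)
  have hmem : x.1 ∈ powCycles F n (contractedExponent p a i) (contractedDegree p k a i) :=
    ⟨x.2, hx0⟩
  rw [h] at hmem
  obtain ⟨y, hy, hxy⟩ := hmem
  have hdeg := contractedDegree_step ha k (rfl : i + 1 = i + 1)
  rw [show contractedDegree p k a i + contractedExponent p a (i + 1) =
    contractedDegree p k a (i + 1) by omega] at hy
  exact ⟨⟨y, hy⟩, Subtype.ext ((contractedComplex_d_apply (ha := ha) rfl ⟨y, hy⟩).trans hxy)⟩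

end Homology

/-! ### Homology at the position of `F Ω_k` -/

section ModuleCat

variable {R : Type*} [Ring R] (K : ChainComplex (ModuleCat R) ℤ) (i : ℤ)

lemma exists_iCycles_eq (x : K.X i) (hx : K.d i (i - 1) x = 0) :
    ∃ z : K.cycles i, K.iCycles i z = x := by
  have h : (ShortComplex.mk _ _ (K.iCycles_d i (i - 1))).Exact :=
    ShortComplex.exact_of_f_is_kernel _
      (K.cyclesIsKernel i (i - 1) (ComplexShape.next_eq' _ (by simp)))
  exact (ShortComplex.moduleCat_exact_iff _).1 h x hx

lemma homologyπ_eq_zero_iff (z : K.cycles i) :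
    K.homologyπ i z = 0 ↔ ∃ y : K.X (i + 1), K.d (i + 1) i y = K.iCycles i z := by
  have h : (ShortComplex.mk _ _ (K.toCycles_comp_homologyπ (i + 1) i)).Exact :=
    ShortComplex.exact_of_g_is_cokernel _
      (K.homologyIsCokernel (i + 1) i (ChainComplex.prev _ _))
  have hd (y : K.X (i + 1)) : K.iCycles i (K.toCycles (i + 1) i y) = K.d (i + 1) i y := by
    rw [← ModuleCat.comp_apply, K.toCycles_i]
  constructor
  · intro hz
    obtain ⟨y, hy⟩ := (ShortComplex.moduleCat_exact_iff _).1 h z hz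
    exact ⟨y, by rw [← hd, ← hy]⟩
  · rintro ⟨y, hy⟩
    rw [← hd] at hy
    rw [← (ModuleCat.mono_iff_injective (K.iCycles i)).1 inferInstance hy, ← ModuleCat.comp_apply,
      K.toCycles_comp_homologyπ]
    rfl

end ModuleCat

section ZeroPosition

variable (F : Type*) [Field F] (p : ℕ) [Fact p.Prime] [CharP F p] (n : ℕ) (k : ℤ)

/-- The map from the cycles of `C(k, 1)` in position `0` to the vectors of `F Ω_k` killed
by `φ`, the identity on underlying vectors. -/
noncomputable def cyclesToSlashCycles :
    (contractedComplex F p n k 1 (one_mem_Icc_of_prime p)).cycles 0 →ₗ[F]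
      slashCycles (subsetModule F n) (subsetBoundary F n) 0 k :=
  LinearMap.codRestrict _ ((subsetModule F n (contractedDegree p k 1 0)).subtype ∘ₗ
    ((contractedComplex F p n k 1 (one_mem_Icc_of_prime p)).iCycles 0).hom) fun z => by
    refine ⟨?_, ?_⟩
    · exact (congrArg (subsetModule F n) (contractedDegree_zero p k 1)).le
        (Subtype.prop (p := (· ∈ subsetModule F n (contractedDegree p k 1 0)))
          ((contractedComplex F p n k 1 (one_mem_Icc_of_prime p)).iCycles 0 z))
    · refine (contractedComplex_d_apply (ha := one_mem_Icc_of_prime p)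
        (sub_add_cancel 0 1)
        ((contractedComplex F p n k 1 (one_mem_Icc_of_prime p)).iCycles 0 z)).symm.trans ?_
      rw [← ModuleCat.comp_apply, HomologicalComplex.iCycles_d]
      rfl

lemma cyclesToSlashCycles_surjective : Function.Surjective (cyclesToSlashCycles F p n k) := by
  rintro ⟨x, hx, hx0⟩
  obtain ⟨y, rfl⟩ : ∃ y : (contractedComplex F p n k 1 (one_mem_Icc_of_prime p)).X 0,
      (subsetModule F n (contractedDegree p k 1 0)).subtype y = x :=
    ⟨⟨x, by rwa [contractedDegree_zero]⟩, rfl⟩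
  obtain ⟨z, hz⟩ := exists_iCycles_eq (contractedComplex F p n k 1 (one_mem_Icc_of_prime p)) 0 y
    (Subtype.ext ((contractedComplex_d_apply (sub_add_cancel 0 1) y).trans hx0))
  exact ⟨z, Subtype.ext (congrArg (subsetModule F n (contractedDegree p k 1 0)).subtype hz)⟩

/-- The class of a cycle in the zeroth slash homology. -/
noncomputable def slashClass (F : Type*) [Field F] (p n : ℕ) (k : ℤ) :
    slashCycles (subsetModule F n) (subsetBoundary F n) 0 k →ₗ[F]
      SlashHomology p (subsetModule F n) (subsetBoundary F n) 0 k :=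
  Submodule.mkQ (M := slashCycles (subsetModule F n) (subsetBoundary F n) 0 k) _

lemma slashClass_eq_zero_iff (F : Type*) [Field F] (p n : ℕ) (k : ℤ)
    (x : slashCycles (subsetModule F n) (subsetBoundary F n) 0 k) :
    slashClass F p n k x = 0 ↔ (x : SubsetSpace F n) ∈ powBoundaries F n (p - 1) k := by
  rw [← slashBoundaries_eq_powBoundaries]
  exact Submodule.Quotient.mk_eq_zero _

lemma ker_homologyπ :
    LinearMap.ker ((contractedComplex F p n k 1 (one_mem_Icc_of_prime p)).homologyπ 0).hom =
      LinearMap.ker (slashClass F p n k ∘ₗ cyclesToSlashCycles F p n k) := by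
  ext z
  rw [LinearMap.mem_ker, LinearMap.mem_ker, LinearMap.comp_apply, slashClass_eq_zero_iff]
  refine (homologyπ_eq_zero_iff _ 0 z).trans ?_
  have he : contractedExponent p 1 (0 + 1) = p - 1 := rfl
  have hdeg : contractedDegree p k 1 (0 + 1) = k + (p - 1 : ℕ) := by
    have := contractedDegree_step (one_mem_Icc_of_prime p) k (rfl : (0 : ℤ) + 1 = 0 + 1)
    rw [contractedDegree_zero, he] at this
    omega
  constructor
  · rintro ⟨y, hy⟩
    have h := contractedComplex_d_apply rfl y
    rw [hy, he] at h
    exact ⟨_, hdeg ▸ y.2, h.symm⟩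
  · rintro ⟨y, hy, hyz⟩
    exact ⟨⟨y, by rwa [hdeg]⟩, Subtype.ext ((contractedComplex_d_apply
      (ha := one_mem_Icc_of_prime p) (rfl : (0 : ℤ) + 1 = 0 + 1) ⟨y, by rwa [hdeg]⟩).trans hyz)⟩

lemma exists_homology_equiv :
    ∃ e : (contractedComplex F p n k 1 (one_mem_Icc_of_prime p)).homology 0 ≃ₗ[F]
        SlashHomology p (subsetModule F n) (subsetBoundary F n) 0 k,
      ∀ (z : (contractedComplex F p n k 1 (one_mem_Icc_of_prime p)).cycles 0)
        (x : slashCycles (subsetModule F n) (subsetBoundary F n) 0 k),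
        (subsetModule F n (contractedDegree p k 1 0)).subtype
          ((contractedComplex F p n k 1 (one_mem_Icc_of_prime p)).iCycles 0 z) = x →
        e ((contractedComplex F p n k 1 (one_mem_Icc_of_prime p)).homologyπ 0 z) =
          Submodule.Quotient.mk x := by
  have hπ : Function.Surjective
      ((contractedComplex F p n k 1 (one_mem_Icc_of_prime p)).homologyπ 0).hom :=
    (ModuleCat.epi_iff_surjective _).1 inferInstance
  have hg : Function.Surjective (slashClass F p n k ∘ₗ cyclesToSlashCycles F p n k) :=
    (Submodule.mkQ_surjective _).comp (cyclesToSlashCycles_surjective F p n k)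
  let e := (LinearMap.quotKerEquivOfSurjective _ hπ).symm ≪≫ₗ
    Submodule.quotEquivOfEq _ _ (ker_homologyπ F p n k) ≪≫ₗ
    LinearMap.quotKerEquivOfSurjective _ hg
  refine ⟨e, fun z x hzx => ?_⟩
  have h1 : (LinearMap.quotKerEquivOfSurjective _ hπ).symm
      (((contractedComplex F p n k 1 (one_mem_Icc_of_prime p)).homologyπ 0).hom z) =
      Submodule.Quotient.mk z := by
    rw [LinearEquiv.symm_apply_eq]
    rfl
  have h2 : cyclesToSlashCycles F p n k z = x := Subtype.ext hzx
  change e (((contractedComplex F p n k 1 (one_mem_Icc_of_prime p)).homologyπ 0).hom z) = _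
  simp only [e, LinearEquiv.trans_apply, h1]
  rw [← h2]
  rfl

end ZeroPosition

theorem lemma4p14 (F : Type*) [Field F] (p : ℕ) [Fact p.Prime] [CharP F p]
    (n : ℕ) (hn : 0 < n) (k : ℤ) (hk0 : 0 ≤ k) (hkn : k ≤ n) :
    -- in the given range, `C(k, 1)` has no homology outside the position of `F Ω_k`
    ((n : ℤ) - ((p : ℤ) - 1) < 2 * k → 2 * k ≤ n → ∀ i : ℤ, i ≠ 0 →
      Limits.IsZero
        ((contractedComplex F p n k 1 (one_mem_Icc_of_prime p)).homology i)) ∧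
    -- `H_k(k, 1) = H_k^{/0}`: the class of a cycle `z` corresponds to the class of `z`
    (∃ e : (contractedComplex F p n k 1 (one_mem_Icc_of_prime p)).homology 0 ≃ₗ[F]
        SlashHomology p (subsetModule F n) (subsetBoundary F n) 0 k,
      ∀ (z : (contractedComplex F p n k 1 (one_mem_Icc_of_prime p)).cycles 0)
        (x : slashCycles (subsetModule F n) (subsetBoundary F n) 0 k),
        (subsetModule F n (contractedDegree p k 1 0)).subtype
          ((contractedComplex F p n k 1 (one_mem_Icc_of_prime p)).iCycles 0 z) = x →
        e ((contractedComplex F p n k 1 (one_mem_Icc_of_prime p)).homologyπ 0 z) =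
          Submodule.Quotient.mk x) ∧
    -- non-vanishing
    (Nontrivial (SlashHomology p (subsetModule F n) (subsetBoundary F n) 0 k) ↔
      (n : ℤ) - ((p : ℤ) - 1) < 2 * k ∧ 2 * k ≤ n ∧ p ≠ 2) ∧
    -- dimension
    ((n : ℤ) - ((p : ℤ) - 1) < 2 * k → 2 * k ≤ n → p ≠ 2 →
      Module.finrank F (SlashHomology p (subsetModule F n) (subsetBoundary F n) 0 k) =
          (latticePaths n k 1 (p - 1)).ncard ∧
        (Module.finrank F (SlashHomology p (subsetModule F n) (subsetBoundary F n) 0 k) : ℤ) =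
          ∑ᶠ j : ℤ, (intChoose n (p * j + k) - intChoose n (p * j + k - 1))) := by
  have hp2 : 2 ≤ p := (Fact.out : p.Prime).two_le
  have hp1 : 1 ∈ Finset.Icc 1 (p - 1) := one_mem_Icc_of_prime p
  refine ⟨fun h1 h2 i hi => contractedComplex_isZero_homology ?_,
    exists_homology_equiv F p n k, ?_, fun h1 h2 _ => ⟨finrank_slashHomology F p n k, ?_⟩⟩
  · have hab := contractedExponent_add hp1 (rfl : i + 1 = i + 1)
    refine powCycles_eq_powBoundaries hab ?_
    rw [powHomologyDim_eq_ncard F p n hab, latticePaths_eq_empty, Set.ncard_empty, Nat.cast_zero]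
    rcases Int.even_or_odd' i with ⟨t, rfl | rfl⟩
    · have e1 : (2 * t) / 2 = t := by omega
      have e2 : ¬ Even (2 * t + 1) := by simp
      simp only [contractedDegree, contractedExponent, even_two_mul, e2, if_true, if_false, e1,
        Nat.cast_sub (show 1 ≤ p by omega)]
      rcases lt_trichotomy t 0 with ht | rfl | ht
      · have : (p : ℤ) * t ≤ p * (-1) := mul_le_mul_of_nonneg_left (by omega) (by omega)
        push_cast
        omega
      · exact absurd rfl hi
      · have : (p : ℤ) * 1 ≤ p * t := mul_le_mul_of_nonneg_left (by omega) (by omega)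
        push_cast
        omega
    · have e1 : (2 * t + 1 + 1) / 2 = t + 1 := by omega
      have e2 : ¬ Even (2 * t + 1) := by simp
      have e3 : Even (2 * t + 1 + 1) := by simp [parity_simps]
      simp only [contractedDegree, contractedExponent, e2, e3, if_true, if_false, e1,
        Nat.cast_sub (show 1 ≤ p by omega)]
      rcases le_or_gt (t + 1) 0 with ht | ht
      · have : (p : ℤ) * (t + 1) ≤ p * 0 := mul_le_mul_of_nonneg_left (by omega) (by omega)
        push_cast
        omega
      · have : (p : ℤ) * 1 ≤ p * (t + 1) := mul_le_mul_of_nonneg_left (by omega) (by omega)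
        push_cast
        omega
  · rw [← Module.finrank_pos_iff (R := F), finrank_slashHomology]
    constructor
    · intro h
      have hne : latticePaths n k 1 (p - 1) ≠ ∅ := fun he => by simp [he] at h
      have hrange := not_imp_comm.1 latticePaths_eq_empty hne
      refine ⟨by omega, by omega, ?_⟩
      rintro rfl
      -- For `p = 2` the strip has no room for a first step.
      obtain ⟨n, rfl⟩ := Nat.exists_eq_add_of_le' hn
      rw [ncard_latticePaths_succ n k 0 0, latticePaths_eq_empty_of_start (Or.inr rfl),
        latticePaths_eq_empty_of_start (Or.inl rfl)] at h
      simp at h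
    · rintro ⟨h1, h2, h3⟩
      exact ncard_latticePaths_pos hk0 hkn one_pos (by omega) (by omega) (by omega) (by omega)
  · rw [finrank_slashHomology, ← finsum_intChoose_eq_ncard (p := p) (by omega) (by omega)
      (by omega) (by omega), Nat.cast_one]
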